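/- Let $C\rightrightarrows X$ be a Lie category: a small category with arrow set $C$ and object set $X$, where $C$ is a smooth finite-dimensional manifold with or without boundary, $X$ is a smooth finite-dimensional manifold without boundary, the source and target maps $s,t\colon C\to X$ are smooth submersions, the unit map $u\colon X\to C$, $x\mapsto 1_x$, and the composition map $m\colon C^{(2)}=\{(g,h)\in C\times C : s(g)=t(h)\}\to C$, $(g,h)\mapsto gh$, are smooth, and the restrictions $s|_{\partial C},t|_{\partial C}\colon \partial C\to X$ are submersions. (Neither the Hausdorff property nor second countability of $C$ and $X$ is needed.) Suppose that $C$ has a normal boundary, that is, either $u(X)\subset\operatorname{Int}C$, or $\partial C$ is a wide subcategory of $C$ (i.e. $u(X)\subset\partial C$ and $\partial C$ is closed under composition). Let $\mathcal G(C)\subset C$ be the core of $C$, i.e. the set of invertible arrows. Then $\mathcal G(C)$ is an embedded Lie subcategory of $C$: with the subspace topology, $\mathcal G(C)$ admits the structure of a smooth manifold (without boundary) for which the inclusion $\mathcal G(C)\hookrightarrow C$ is a smooth embedding and for which $\mathcal G(C)\rightrightarrows X$, with the restricted structure maps, is a Lie category. Moreover: - if $u(X)\subset\operatorname{Int}C$,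 then $\mathcal G(C)$ is contained and open in $\operatorname{Int}C$; - if $u(X)\subset\partial C$, then $\mathcal G(C)$ is contained and open in $\partial C$. -/

import Mathlib

open Set Manifold
open scoped ContDiff

noncomputable section

/-- A small category `C ⇉ X` in arrows-and-objects form: `C` is the set of arrows, `X` the set of
objects, `src g`, `tgt g` are the source and target of `g`, `unit x` is the identity arrow `1_x`,
and `comp g h` is the composite `gh`, defined exactly when `src g = tgt h`. -/
structure ArrowCategory (X C : Type*) where
  src : C → X
  tgt : C → X
  unit : X → C
  comp : (g h : C) → src g = tgt h → C
  src_unit : ∀ x, src (unit x) = x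
  tgt_unit : ∀ x, tgt (unit x) = x
  src_comp : ∀ g h hgh, src (comp g h hgh) = src h
  tgt_comp : ∀ g h hgh, tgt (comp g h hgh) = tgt g
  unit_comp : ∀ g, comp (unit (tgt g)) g (src_unit (tgt g)) = g
  comp_unit : ∀ g, comp g (unit (src g)) (tgt_unit (src g)).symm = g
  assoc : ∀ g h k (hgh : src g = tgt h) (hhk : src h = tgt k),
    comp (comp g h hgh) k ((src_comp g h hgh).trans hhk) =
      comp g (comp h k hhk) (hgh.trans (tgt_comp h k hhk).symm)

namespace ArrowCategory

variable {X C : Type*} (A : ArrowCategory X C)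

/-- The set `C⁽²⁾ ⊆ C × C` of composable pairs. -/
def composable : Set (C × C) := {p | A.src p.1 = A.tgt p.2}

open Classical in
/-- The composition map `(g, h) ↦ gh`, extended by an irrelevant value outside `C⁽²⁾`; it is only
ever used on `A.composable`. -/
def compMap (p : C × C) : C :=
  if h : A.src p.1 = A.tgt p.2 then A.comp p.1 p.2 h else p.1

/-- `g` is invertible: it has a two-sided inverse `g'`. -/
def IsInvertible (g : C) : Prop :=
  ∃ (g' : C) (h₁ : A.src g' = A.tgt g) (h₂ : A.src g = A.tgt g'),
    A.comp g' g h₁ = A.unit (A.src g) ∧ A.comp g g' h₂ = A.unit (A.tgt g)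

/-- The core `𝒢(C)`: the set of invertible arrows. -/
def core : Set C := {g | A.IsInvertible g}

/-- A set of arrows `S` is (the arrow set of) a wide subcategory: it contains all units and is
closed under composition. -/
structure IsWideSubcategory (S : Set C) : Prop where
  unit_mem : ∀ x, A.unit x ∈ S
  comp_mem : ∀ g h hgh, g ∈ S → h ∈ S → A.comp g h hgh ∈ S

/-- A wide subcategory `S ⇉ X` as a category, with the structure maps of `C ⇉ X` restricted. -/
def restrict (S : Set C) (hS : A.IsWideSubcategory S) : ArrowCategory X S where
  src g := A.src g
  tgt g := A.tgt g
  unit x := ⟨A.unit x, hS.unit_mem x⟩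
  comp g h hgh := ⟨A.comp g h hgh, hS.comp_mem g h hgh g.2 h.2⟩
  src_unit := A.src_unit
  tgt_unit := A.tgt_unit
  src_comp g h := A.src_comp g h
  tgt_comp g h := A.tgt_comp g h
  unit_comp g := Subtype.ext (A.unit_comp g)
  comp_unit g := Subtype.ext (A.comp_unit g)
  assoc g h k hgh hhk := Subtype.ext (A.assoc g h k hgh hhk)

theorem comp_congr {g g' h h' : C} (hg : g = g') (hh : h = h') (e : A.src g = A.tgt h)
    (e' : A.src g' = A.tgt h') : A.comp g h e = A.comp g' h' e' := by
  subst hg; subst hh; rfl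

/-- Units are invertible and composites of invertible arrows are invertible. -/
theorem core_isWideSubcategory : A.IsWideSubcategory A.core where
  unit_mem x := by
    have e : A.src (A.unit x) = A.tgt (A.unit x) := by rw [A.src_unit, A.tgt_unit]
    refine ⟨A.unit x, e, e, ?_, ?_⟩
    · exact (A.comp_congr rfl (by rw [A.src_unit]) _ _).trans (A.comp_unit (A.unit x)) |>.trans
        (by rw [A.src_unit])
    · exact (A.comp_congr rfl (by rw [A.src_unit]) _ _).trans (A.comp_unit (A.unit x)) |>.trans
        (by rw [A.tgt_unit])
  comp_mem := by
    rintro g h hgh ⟨g', a₁, a₂, a₃, a₄⟩ ⟨h', b₁, b₂, b₃, b₄⟩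
    have e : A.src h' = A.tgt g' := b₁.trans (hgh.symm.trans a₂)
    refine ⟨A.comp h' g' e, ?_, ?_, ?_, ?_⟩
    · rw [A.src_comp, A.tgt_comp, a₁]
    · rw [A.src_comp, A.tgt_comp, b₂]
    · have k₁ : A.src g' = A.tgt (A.comp g h hgh) := by rw [A.tgt_comp, a₁]
      rw [A.assoc h' g' (A.comp g h hgh) e k₁]
      have k₂ : A.comp g' (A.comp g h hgh) k₁ = h := by
        rw [← A.assoc g' g h a₁ hgh]
        exact (A.comp_congr (a₃.trans (by rw [hgh])) rfl _ _).trans (A.unit_comp h)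
      rw [A.comp_congr rfl k₂ _ b₁, b₃, A.src_comp]
    · have k₁ : A.src h = A.tgt (A.comp h' g' e) := by rw [A.tgt_comp, b₂]
      rw [A.assoc g h (A.comp h' g' e) hgh k₁]
      have k₂ : A.comp h (A.comp h' g' e) k₁ = g' := by
        rw [← A.assoc h h' g' b₂ e]
        exact (A.comp_congr (b₄.trans (by rw [← hgh, a₂])) rfl _ _).trans (A.unit_comp g')
      rw [A.comp_congr rfl k₂ _ a₂, a₄, A.tgt_comp]

end ArrowCategory

section Manifolds

variable {E H F : Type*} [NormedAddCommGroup E] [NormedSpace ℝ E] [TopologicalSpace H]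
  [NormedAddCommGroup F] [NormedSpace ℝ F]

/-- The model `I` is that of manifolds with or without boundary: its range is
`{v | 0 ≤ lam v}` for a covector `lam`. This is a closed half-space of `E` if `lam ≠ 0`, and all
of `E` (manifolds without boundary) if `lam = 0`. -/
def IsBoundaryModel (I : ModelWithCorners ℝ E H) (lam : E →L[ℝ] ℝ) : Prop :=
  range I = {v | 0 ≤ lam v}

/-- The tangent space `T_p(∂M) ⊆ T_p M` of the boundary at a boundary point `p`. Mathlib identifies
`T_p M` with `E` through the preferred chart at `p`; that chart maps `M` to `{v | 0 ≤ lam v}` and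
`∂M` to the hyperplane `{v | lam v = 0}`. -/
def boundaryTangentSpace (I : ModelWithCorners ℝ E H) (lam : E →L[ℝ] ℝ)
    {M : Type*} [TopologicalSpace M] [ChartedSpace H M] (p : M) :
    Submodule ℝ (TangentSpace I p) :=
  LinearMap.ker (lam : E →ₗ[ℝ] ℝ)

/-- `f : M → X` is a smooth submersion: smooth, with surjective differential at every point. -/
def IsSmoothSubmersion (I : ModelWithCorners ℝ E H) {M X : Type*}
    [TopologicalSpace M] [ChartedSpace H M] [TopologicalSpace X] [ChartedSpace F X]
    (f : M → X) : Prop :=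
  ContMDiff I 𝓘(ℝ, F) ∞ f ∧ ∀ p : M, Function.Surjective (mfderiv I 𝓘(ℝ, F) f p)

/-- For a smooth `f : M → X`, the restriction `∂f : ∂M → X` is a submersion: at every boundary
point `p`, the differential `d(∂f)_p`, that is `df_p` restricted to `T_p(∂M)`, is surjective. -/
def IsBoundarySubmersion (I : ModelWithCorners ℝ E H) (lam : E →L[ℝ] ℝ) {M X : Type*}
    [TopologicalSpace M] [ChartedSpace H M] [TopologicalSpace X] [ChartedSpace F X]
    (f : M → X) : Prop :=
  ∀ p ∈ I.boundary M, ∀ w : TangentSpace 𝓘(ℝ, F) (f p),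
    ∃ v ∈ boundaryTangentSpace I lam p, mfderiv I 𝓘(ℝ, F) f p v = w

namespace ArrowCategory

variable {X C : Type*} [TopologicalSpace X] [ChartedSpace F X]
  [TopologicalSpace C] [ChartedSpace H C]

/-- `C ⇉ X` is a Lie category (with regular boundary): `C` is a smooth finite-dimensional manifold
with or without boundary, modelled on `I` with half-space covector `lam`; `X` is a smooth
finite-dimensional manifold without boundary, modelled on `F`; source and target and their
restrictions to `∂C` are submersions; units and composition are smooth. By the submersion
conditions `C⁽²⁾` is a submanifold (with corners) of `C × C`, so that a map on it is smooth for the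
induced structure iff it is smooth along the subset `C⁽²⁾` of `C × C`. -/
structure IsLieCategory (A : ArrowCategory X C) (I : ModelWithCorners ℝ E H)
    (lam : E →L[ℝ] ℝ) : Prop where
  finiteDimensional_arrows : FiniteDimensional ℝ E
  finiteDimensional_objects : FiniteDimensional ℝ F
  boundaryModel : IsBoundaryModel I lam
  manifold_arrows : IsManifold I ∞ C
  manifold_objects : IsManifold 𝓘(ℝ, F) ∞ X
  src_submersion : IsSmoothSubmersion (F := F) I A.src
  tgt_submersion : IsSmoothSubmersion (F := F) I A.tgt
  unit_smooth : ContMDiff 𝓘(ℝ, F) I ∞ A.unit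
  comp_smooth : ContMDiffOn (I.prod I) I ∞ A.compMap A.composable
  src_boundary_submersion : IsBoundarySubmersion (F := F) I lam A.src
  tgt_boundary_submersion : IsBoundarySubmersion (F := F) I lam A.tgt

/-- `C ⇉ X` has a normal boundary: either all units lie in the interior of `C`, or `∂C` is a wide
subcategory of `C`. -/
def HasNormalBoundary (A : ArrowCategory X C) (I : ModelWithCorners ℝ E H) : Prop :=
  (∀ x, A.unit x ∈ I.interior C) ∨ A.IsWideSubcategory (I.boundary C)

/-- The wide subcategory `S ⇉ X`, with `S` carrying the subspace topology and the smooth structure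
given by an atlas modelled on `I'` (with half-space covector `lam'`), is an embedded Lie subcategory
of `C ⇉ X`: it is a Lie category over the same base manifold, and the inclusion functor is a smooth
embedding. -/
structure IsEmbeddedLieSubcategory (A : ArrowCategory X C) (I : ModelWithCorners ℝ E H)
    {E' H' : Type*} [NormedAddCommGroup E'] [NormedSpace ℝ E'] [TopologicalSpace H']
    (I' : ModelWithCorners ℝ E' H') (lam' : E' →L[ℝ] ℝ)
    (S : Set C) [ChartedSpace H' S] (hS : A.IsWideSubcategory S) : Prop where
  isLieCategory : IsLieCategory (F := F) (A.restrict S hS) I' lam'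
  inclusion_embedding : IsSmoothEmbedding I' I ∞ (Subtype.val : S → C)

end ArrowCategory

end Manifolds

end

/-!
# The core of a Lie category with normal boundary

The proof has two parts.

*Position of the core.* Left translation by an invertible arrow `a` is a bijection between
`tgt`-fibres, smooth with smooth inverse. Since `tgt` restricts to a submersion on the boundary, the
fibres are transverse to the boundary. If `h` is an interior point but `ah` is a boundary point,
then, in the half-space chart at `ah`, the translated fibre has a minimum of the boundary covector
at `ah`, so its whole tangent space is contained in the intersection of the tangent space of the
boundary with that of a fibre, which has too small a dimension. Hence translations preserve the
interior (`ArrowCategory.IsInverse.compMap_mem_interior`); translating units to arbitrary invertible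
arrows and back, the core lies in the interior or in the boundary according to where the units lie.

*Openness.* Let `S` be the interior or the boundary of `C`, whichever contains the units. It is a
manifold without boundary on which source and target are still submersions. Parametrizing
`tgt`-fibres by the implicit function theorem (`exists_submersion_coordinates`), the equation
`g h = 1` for the unknown `h` in the `tgt`-fibre over `src g` becomes an equation between vector
spaces; at an invertible `g₀` its linearization is surjective because left translation by `g₀⁻¹` is
a right inverse of left translation by `g₀`. So every `g ∈ S` near `g₀` has a right inverse near
`g₀⁻¹` (`eventually_exists_right_inverse`). Applying this at `g₀⁻¹` as well, that right inverse has itself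
a right inverse, which forces `g` to be invertible (`ArrowCategory.isOpen_core_of_sliceData`).

The interior and the boundary are handled uniformly as `SliceData`: subsets which the preferred
charts of `C` map to an open piece of a linear subspace. Restricting those charts gives the smooth
structure on the core; in these charts the inclusion is linear, so it is an immersion, and
smoothness of the structure maps is inherited from `C`.
-/

open Filter Topology

/-! ### Subsets that are slices of the preferred charts -/

section Slices

variable {E H V : Type*} [NormedAddCommGroup E] [NormedSpace ℝ E] [TopologicalSpace H]
  [NormedAddCommGroup V] [NormedSpace ℝ V]
  {C : Type*} [TopologicalSpace C] [ChartedSpace H C]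

/-- A presentation of `T ⊆ C` as a submanifold without boundary that is flat in every preferred
chart of `C`: inside an open set `dom`, the points of `T` are exactly those which a chart sends to
`incl '' region`, where `incl : V → E` is a linear embedding with retraction `retr` and `region` is
open in `V`. Both the interior (`incl` an isomorphism, `region` the open half-space) and the
boundary (`incl` onto the bounding hyperplane, `region` everything) of a manifold with boundary have
this form. -/
structure SliceData (I : ModelWithCorners ℝ E H) (V : Type*) [NormedAddCommGroup V]
    [NormedSpace ℝ V] (T : Set C) where
  incl : V →L[ℝ] E
  retr : E →L[ℝ] V
  retr_incl : ∀ v, retr (incl v) = v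
  region : Set V
  isOpen_region : IsOpen region
  incl_mem_range : ∀ v ∈ region, incl v ∈ range I
  dom : Set C
  isOpen_dom : IsOpen dom
  mem_iff : ∀ p q : C, q ∈ (chartAt H p).source →
    (q ∈ T ↔ q ∈ dom ∧ extChartAt I p q ∈ incl '' region)

namespace SliceData

variable {I : ModelWithCorners ℝ E H} {T : Set C} (D : SliceData I V T)

/-- The part of a slice lying in a further open set is again a slice. -/
def restrictOpen {T' O : Set C} (hO : IsOpen O) (hT' : T' = T ∩ O) : SliceData I V T' where
  incl := D.incl
  retr := D.retr
  retr_incl := D.retr_incl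
  region := D.region
  isOpen_region := D.isOpen_region
  incl_mem_range := D.incl_mem_range
  dom := D.dom ∩ O
  isOpen_dom := D.isOpen_dom.inter hO
  mem_iff p q hq := by
    rw [hT', mem_inter_iff, D.mem_iff p q hq, mem_inter_iff]
    tauto

theorem incl_retr_extChartAt (p : C) {q : C} (hq : q ∈ (chartAt H p).source) (hT : q ∈ T) :
    D.incl (D.retr (extChartAt I p q)) = extChartAt I p q := by
  obtain ⟨-, v, -, hv⟩ := (D.mem_iff p q hq).1 hT
  rw [← hv, D.retr_incl]

theorem retr_extChartAt_mem (p : C) {q : C} (hq : q ∈ (chartAt H p).source) (hT : q ∈ T) :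
    D.retr (extChartAt I p q) ∈ D.region := by
  obtain ⟨-, v, hv', hv⟩ := (D.mem_iff p q hq).1 hT
  rwa [← hv, D.retr_incl]

/-- The image of the slice `T` in the linear coordinates of the chart at `p`. -/
def chartTarget (p : C) : Set V :=
  {v | v ∈ D.region ∧ I.symm (D.incl v) ∈ (chartAt H p).target ∧
    (extChartAt I p).symm (D.incl v) ∈ D.dom}

theorem incl_mem_target {p : C} {v : V} (hv : v ∈ D.chartTarget p) :
    D.incl v ∈ (extChartAt I p).target := by
  rw [extChartAt_target]
  exact ⟨hv.2.1, D.incl_mem_range v hv.1⟩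

theorem symm_mem_source {p : C} {v : V} (hv : v ∈ D.chartTarget p) :
    (extChartAt I p).symm (D.incl v) ∈ (chartAt H p).source := by
  rw [← extChartAt_source I]
  exact (extChartAt I p).map_target (D.incl_mem_target hv)

theorem symm_mem {p : C} {v : V} (hv : v ∈ D.chartTarget p) :
    (extChartAt I p).symm (D.incl v) ∈ T := by
  rw [D.mem_iff p _ (D.symm_mem_source hv), (extChartAt I p).right_inv (D.incl_mem_target hv)]
  exact ⟨hv.2.2, v, hv.1, rfl⟩

theorem retr_mem_chartTarget {p : C} {q : C} (hq : q ∈ (chartAt H p).source) (hT : q ∈ T) :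
    D.retr (extChartAt I p q) ∈ D.chartTarget p := by
  have hq' : q ∈ (extChartAt I p).source := by rwa [extChartAt_source]
  refine ⟨D.retr_extChartAt_mem p hq hT, ?_, ?_⟩
  · rw [D.incl_retr_extChartAt p hq hT]
    have := (extChartAt I p).map_source hq'
    rw [extChartAt_target] at this
    exact this.1
  · rw [D.incl_retr_extChartAt p hq hT, (extChartAt I p).left_inv hq']
    exact ((D.mem_iff p q hq).1 hT).1

theorem isOpen_chartTarget (p : C) : IsOpen (D.chartTarget p) := by
  have h1 : IsOpen (D.region ∩ (fun v => I.symm (D.incl v)) ⁻¹' (chartAt H p).target) :=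
    D.isOpen_region.inter
      ((chartAt H p).open_target.preimage (I.continuous_symm.comp D.incl.continuous))
  have h2 : ContinuousOn (fun v => (extChartAt I p).symm (D.incl v))
      (D.region ∩ (fun v => I.symm (D.incl v)) ⁻¹' (chartAt H p).target) := by
    refine (continuousOn_extChartAt_symm p).comp D.incl.continuous.continuousOn ?_
    intro v hv
    rw [extChartAt_target]
    exact ⟨hv.2, D.incl_mem_range v hv.1⟩
  have h3 := h2.isOpen_inter_preimage h1 D.isOpen_dom
  convert h3 using 1
  ext v
  simp only [chartTarget, mem_ofPred_eq, mem_inter_iff, mem_preimage]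
  tauto

open Classical in
/-- The chart of a slice `T` induced by the preferred chart of `C` at `p ∈ T`. Outside
`chartTarget` its inverse takes the irrelevant value `p`. -/
noncomputable def chart (p : T) : OpenPartialHomeomorph T V where
  toFun q := D.retr (extChartAt I (p : C) q)
  invFun v := if h : (extChartAt I (p : C)).symm (D.incl v) ∈ T then ⟨_, h⟩ else p
  source := Subtype.val ⁻¹' (chartAt H (p : C)).source
  target := D.chartTarget p
  map_source' q hq := D.retr_mem_chartTarget hq q.2
  map_target' v hv := by
    rw [dif_pos (D.symm_mem hv)]
    exact D.symm_mem_source hv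
  left_inv' q hq := by
    have hq' : (q : C) ∈ (extChartAt I (p : C)).source := by rwa [extChartAt_source]
    have e : (extChartAt I (p : C)).symm (D.incl (D.retr (extChartAt I (p : C) q))) = q := by
      rw [D.incl_retr_extChartAt p hq q.2, (extChartAt I (p : C)).left_inv hq']
    have hT := q.2
    rw [← e] at hT
    rw [dif_pos hT]
    exact Subtype.ext e
  right_inv' v hv := by
    rw [dif_pos (D.symm_mem hv)]
    simp only
    rw [(extChartAt I (p : C)).right_inv (D.incl_mem_target hv), D.retr_incl]
  open_source := (chartAt H (p : C)).open_source.preimage continuous_subtype_val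
  open_target := D.isOpen_chartTarget p
  continuousOn_toFun := by
    refine D.retr.continuous.comp_continuousOn ?_
    refine (continuousOn_extChartAt (p : C)).comp continuous_subtype_val.continuousOn ?_
    intro q hq
    rwa [extChartAt_source]
  continuousOn_invFun := by
    rw [Topology.IsInducing.subtypeVal.continuousOn_iff]
    have h2 : ContinuousOn (fun v => (extChartAt I (p : C)).symm (D.incl v)) (D.chartTarget p) :=
      (continuousOn_extChartAt_symm (p : C)).comp D.incl.continuous.continuousOn
        fun v hv => D.incl_mem_target hv
    exact h2.congr fun v hv => congrArg Subtype.val (dif_pos (D.symm_mem hv))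

theorem coe_chart_symm (p : T) {v : V} (hv : v ∈ D.chartTarget p) :
    (((D.chart p).symm v : T) : C) = (extChartAt I (p : C)).symm (D.incl v) := by
  exact congrArg Subtype.val (dif_pos (D.symm_mem hv))

/-- The atlas of a slice. -/
@[reducible]
noncomputable def chartedSpace : ChartedSpace V T where
  atlas := range D.chart
  chartAt := D.chart
  mem_chart_source p := mem_chart_source H (p : C)
  chart_mem_atlas p := mem_range_self p

theorem isManifold [IsManifold I ∞ C] :
    @IsManifold ℝ _ V _ _ V _ 𝓘(ℝ, V) ∞ T _ D.chartedSpace := by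
  let _ := D.chartedSpace
  refine isManifold_of_contDiffOn 𝓘(ℝ, V) ∞ T ?_
  rintro _ _ ⟨p, rfl⟩ ⟨q, rfl⟩
  have h1 := contDiffOn_ext_coord_change (I := I) (n := ∞) (q : C) (p : C)
  have h2 : ContDiffOn ℝ ∞ (fun v => D.retr
      ((extChartAt I (q : C) ∘ (extChartAt I (p : C)).symm) (D.incl v)))
      ((D.chart p).symm ≫ₕ D.chart q).source := by
    refine D.retr.contDiff.comp_contDiffOn (h1.comp D.incl.contDiff.contDiffOn ?_)
    rintro v ⟨hv, hv'⟩
    change (((D.chart p).symm v : T) : C) ∈ (chartAt H (q : C)).source at hv'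
    rw [D.coe_chart_symm p hv] at hv'
    refine ⟨D.incl_mem_target hv, ?_⟩
    rw [mem_preimage, extChartAt_source]
    exact hv'
  have h3 : (𝓘(ℝ, V).symm ⁻¹' ((D.chart p).symm ≫ₕ D.chart q).source ∩ range 𝓘(ℝ, V)) =
      ((D.chart p).symm ≫ₕ D.chart q).source := by simp
  rw [h3]
  refine h2.congr ?_
  rintro v ⟨hv, hv'⟩
  change D.retr (extChartAt I (q : C) (((D.chart p).symm v : T) : C)) = _
  rw [D.coe_chart_symm p hv]
  rfl

variable {N E'' H'' : Type*} [NormedAddCommGroup E''] [NormedSpace ℝ E''] [TopologicalSpace H'']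
  {J : ModelWithCorners ℝ E'' H''} [TopologicalSpace N] [ChartedSpace H'' N]

/-- A map into a slice is smooth if it is smooth as a map into the ambient manifold. -/
theorem contMDiffWithinAt_of_val {n : ℕ∞ω} {f : N → T} {s : Set N} {x : N}
    (hf : ContMDiffWithinAt J I n (fun y => (f y : C)) s x) :
    letI := D.chartedSpace
    ContMDiffWithinAt J 𝓘(ℝ, V) n f s x := by
  let _ := D.chartedSpace
  rw [contMDiffWithinAt_iff_target] at hf ⊢
  refine ⟨Topology.IsInducing.subtypeVal.continuousWithinAt_iff.2 hf.1, ?_⟩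
  exact D.retr.contMDiff.contMDiffAt.comp_contMDiffWithinAt _ hf.2

theorem contMDiffAt_of_val {n : ℕ∞ω} {f : N → T} {x : N}
    (hf : ContMDiffAt J I n (fun y => (f y : C)) x) :
    letI := D.chartedSpace
    ContMDiffAt J 𝓘(ℝ, V) n f x :=
  D.contMDiffWithinAt_of_val hf

theorem contMDiff_val :
    letI := D.chartedSpace
    ContMDiff 𝓘(ℝ, V) I ∞ (Subtype.val : T → C) := by
  let _ := D.chartedSpace
  intro p
  rw [contMDiffAt_iff_target]
  refine ⟨continuous_subtype_val.continuousAt, ?_⟩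
  have h : ContMDiffAt 𝓘(ℝ, V) 𝓘(ℝ, E) ∞ (D.incl ∘ extChartAt 𝓘(ℝ, V) p) p :=
    D.incl.contMDiff.contMDiffAt.comp p contMDiffAt_extChartAt
  refine h.congr_of_eventuallyEq ?_
  filter_upwards [(chartAt V p).open_source.mem_nhds (mem_chart_source V p)] with q hq
  exact (D.incl_retr_extChartAt (p : C) hq q.2).symm

/-- In the preferred charts at a point of the slice, the differential of the inclusion is the
linear embedding `incl` itself. -/
theorem hasMFDerivAt_val (p : T) :
    letI := D.chartedSpace
    HasMFDerivAt 𝓘(ℝ, V) I (Subtype.val : T → C) p D.incl := by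
  let _ := D.chartedSpace
  refine ⟨continuous_subtype_val.continuousAt, ?_⟩
  have h : HasFDerivAt D.incl D.incl (extChartAt 𝓘(ℝ, V) p p) := D.incl.hasFDerivAt
  refine (h.congr_of_eventuallyEq ?_).hasFDerivWithinAt
  have ht : D.chartTarget p ∈ 𝓝 (extChartAt 𝓘(ℝ, V) p p) :=
    (D.isOpen_chartTarget p).mem_nhds
      (D.retr_mem_chartTarget (mem_chart_source H (p : C)) p.2)
  filter_upwards [ht] with v hv
  change extChartAt I (p : C) (((D.chart p).symm v : T) : C) = D.incl v
  rw [D.coe_chart_symm p hv, (extChartAt I (p : C)).right_inv (D.incl_mem_target hv)]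

/-- The model space splits as the direction of the slice and the kernel of the retraction. -/
noncomputable def splitting : (V × D.retr.ker) ≃L[ℝ] E :=
  ContinuousLinearEquiv.equivOfInverse
    (D.incl.comp (ContinuousLinearMap.fst ℝ V D.retr.ker) +
      D.retr.ker.subtypeL.comp (ContinuousLinearMap.snd ℝ V D.retr.ker))
    (D.retr.prod ((ContinuousLinearMap.id ℝ E - D.incl.comp D.retr).codRestrict D.retr.ker
      (fun x => by simp [D.retr_incl])))
    (by
      rintro ⟨v, w, hw⟩
      have hw' : D.retr w = 0 := hw
      ext <;> simp [D.retr_incl, hw'])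
    (by intro x; simp)

theorem isSmoothEmbedding_val [IsManifold I ∞ C] :
    letI := D.chartedSpace
    IsSmoothEmbedding 𝓘(ℝ, V) I ∞ (Subtype.val : T → C) := by
  let _ := D.chartedSpace
  have := D.isManifold
  refine ⟨⟨D.retr.ker, inferInstance, inferInstance, fun p => ?_⟩, IsEmbedding.subtypeVal⟩
  refine IsImmersionAtOfComplement.mk_of_charts D.splitting (chartAt V p) (chartAt H (p : C))
    (mem_chart_source V p) (mem_chart_source H (p : C)) (IsManifold.chart_mem_maximalAtlas p)
    (IsManifold.chart_mem_maximalAtlas (p : C)) (fun q hq => hq) ?_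
  intro v hv
  have hv' : v ∈ D.chartTarget p := by
    have : v ∈ (extChartAt 𝓘(ℝ, V) p).target := hv
    rw [extChartAt_target] at this
    exact this.1
  change extChartAt I (p : C) (((D.chart p).symm v : T) : C) = _
  rw [D.coe_chart_symm p hv', (extChartAt I (p : C)).right_inv (D.incl_mem_target hv')]
  simp [splitting]

end SliceData

end Slices

/-! ### The interior and the boundary as slices -/

section InteriorBoundary

variable {E H V : Type*} [NormedAddCommGroup E] [NormedSpace ℝ E] [TopologicalSpace H]
  [NormedAddCommGroup V] [NormedSpace ℝ V] {I : ModelWithCorners ℝ E H} {lam : E →L[ℝ] ℝ}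
  {C : Type*} [TopologicalSpace C] [ChartedSpace H C]

theorem isInteriorPoint_iff_extChartAt_mem [IsManifold I ∞ C] {p q : C}
    (hq : q ∈ (chartAt H p).source) :
    I.IsInteriorPoint q ↔ extChartAt I p q ∈ interior (range I) := by
  rw [I.isInteriorPoint_iff_of_mem_atlas (n := ∞) (by simp) (chart_mem_atlas H p) hq]
  constructor
  · exact fun h => interior_mono (extChartAt_target_subset_range p) h
  · exact fun h => (chartAt H p).mem_interior_extend_target ((chartAt H p).map_source hq) h

theorem IsBoundaryModel.interior_range_eq (hI : IsBoundaryModel I lam) (hlam : lam ≠ 0) :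
    interior (range I) = {v | 0 < lam v} := by
  have ho : IsOpenMap lam := lam.isOpenMap_of_ne_zero hlam
  have h : range I = lam ⁻¹' Ici 0 := hI
  rw [h, ← ho.preimage_interior_eq_interior_preimage lam.continuous, interior_Ici]
  rfl

theorem IsBoundaryModel.isInteriorPoint_of_eq_zero (hI : IsBoundaryModel I lam) (hlam : lam = 0)
    (q : C) : I.IsInteriorPoint q := by
  have h : range I = univ := by
    rw [hI, hlam]
    ext
    simp
  simp [ModelWithCorners.IsInteriorPoint, h]

theorem isBoundaryPoint_iff_extChartAt_eq_zero [IsManifold I ∞ C] (hI : IsBoundaryModel I lam)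
    (hlam : lam ≠ 0) {p q : C} (hq : q ∈ (chartAt H p).source) :
    I.IsBoundaryPoint q ↔ lam (extChartAt I p q) = 0 := by
  rw [I.isBoundaryPoint_iff_not_isInteriorPoint, isInteriorPoint_iff_extChartAt_mem hq,
    hI.interior_range_eq hlam]
  have h : extChartAt I p q ∈ range I := extChartAt_target_subset_range p
    ((extChartAt I p).map_source (by rwa [extChartAt_source]))
  rw [hI] at h
  exact ⟨fun h' => le_antisymm (not_lt.1 h') h, fun h' => not_lt.2 h'.le⟩

/-- The interior of a manifold with boundary as a slice. -/
def SliceData.interior [IsManifold I ∞ C] (L : E ≃L[ℝ] V) :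
    SliceData I V (I.interior C) where
  incl := L.symm
  retr := L
  retr_incl v := by simp
  region := L.symm ⁻¹' _root_.interior (range I)
  isOpen_region := isOpen_interior.preimage L.symm.continuous
  incl_mem_range v hv := interior_subset hv
  dom := univ
  isOpen_dom := isOpen_univ
  mem_iff p q hq := by
    refine (isInteriorPoint_iff_extChartAt_mem hq).trans ?_
    simp only [mem_univ, true_and]
    constructor
    · exact fun h => ⟨L (extChartAt I p q), by simpa using h, by simp⟩
    · rintro ⟨v, hv, h⟩
      rw [← h]
      exact hv

/-- The boundary of a manifold with boundary as a slice; `j` identifies the space `V` with the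
hyperplane bounding the half-space, and `r` is a retraction. -/
def SliceData.boundary [IsManifold I ∞ C] (hI : IsBoundaryModel I lam) (hlam : lam ≠ 0)
    (j : V →L[ℝ] E) (r : E →L[ℝ] V) (hrj : ∀ v, r (j v) = v) (hj : range j = {v | lam v = 0}) :
    SliceData I V (I.boundary C) where
  incl := j
  retr := r
  retr_incl := hrj
  region := univ
  isOpen_region := isOpen_univ
  incl_mem_range v _ := by
    have h : j v ∈ {v | lam v = 0} := hj ▸ mem_range_self v
    rw [hI]
    exact h.ge
  dom := univ
  isOpen_dom := isOpen_univ
  mem_iff p q hq := by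
    refine (isBoundaryPoint_iff_extChartAt_eq_zero hI hlam hq).trans ?_
    rw [image_univ, hj]
    simp

theorem exists_linear_parametrization_ker [FiniteDimensional ℝ E] (lam : E →L[ℝ] ℝ) :
    ∃ (k : ℕ) (j : EuclideanSpace ℝ (Fin k) →L[ℝ] E) (r : E →L[ℝ] EuclideanSpace ℝ (Fin k)),
      (∀ v, r (j v) = v) ∧ range j = {v | lam v = 0} := by
  obtain ⟨P, hP⟩ := Submodule.ClosedComplemented.of_finiteDimensional lam.ker
  let L : lam.ker ≃L[ℝ] EuclideanSpace ℝ (Fin (Module.finrank ℝ lam.ker)) :=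
    ContinuousLinearEquiv.ofFinrankEq (by simp)
  refine ⟨Module.finrank ℝ lam.ker, lam.ker.subtypeL.comp L.symm.toContinuousLinearMap,
    L.toContinuousLinearMap.comp P, fun v => by simp [hP], ?_⟩
  ext v
  constructor
  · rintro ⟨w, rfl⟩
    exact (L.symm w).2
  · intro hv
    exact ⟨L ⟨v, hv⟩, by simp⟩

end InteriorBoundary

/-! ### Submersions near an interior point -/

section Submersion

variable {E H F : Type*} [NormedAddCommGroup E] [NormedSpace ℝ E] [TopologicalSpace H]
  [NormedAddCommGroup F] [NormedSpace ℝ F]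
  {I : ModelWithCorners ℝ E H}
  {M : Type*} [TopologicalSpace M] [ChartedSpace H M]
  {X : Type*} [TopologicalSpace X] [ChartedSpace F X]

theorem extChartAt_target_mem_nhds_of_isInteriorPoint {p : M} (hp : I.IsInteriorPoint p) :
    (extChartAt I p).target ∈ 𝓝 (extChartAt I p p) := by
  rw [← mem_interior_iff_mem_nhds]
  exact (chartAt H p).mem_interior_extend_target (mem_chart_target H p) hp

/-- Local form of a submersion `f` at an interior point `p`: near `p`, the pair `(f, π)` is a
diffeomorphism onto an open subset of `X × K`, with inverse `ι`. -/
theorem exists_submersion_coordinates [FiniteDimensional ℝ E] [FiniteDimensional ℝ F]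
    [IsManifold I ∞ M] {f : M → X} {p : M} (hf : ContMDiffAt I 𝓘(ℝ, F) ∞ f p)
    (hp : I.IsInteriorPoint p) (hs : Function.Surjective (mfderiv I 𝓘(ℝ, F) f p)) :
    ∃ (K : Submodule ℝ E) (ι : X × K → M) (π : M → K),
      Module.finrank ℝ F + Module.finrank ℝ K = Module.finrank ℝ E ∧
      ι (f p, 0) = p ∧ π p = 0 ∧
      ContMDiffAt (𝓘(ℝ, F).prod 𝓘(ℝ, K)) I ∞ ι (f p, 0) ∧
      ContMDiffAt I 𝓘(ℝ, K) ∞ π p ∧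
      (∀ᶠ z in 𝓝 (f p, (0 : K)), f (ι z) = z.1) ∧
      (∀ᶠ z in 𝓝 (f p, (0 : K)), π (ι z) = z.2) ∧
      ∀ᶠ q in 𝓝 p, ι (f q, π q) = q := by
  set e := extChartAt I p with he
  set c := extChartAt 𝓘(ℝ, F) (f p) with hc
  set a := e p with ha
  have htgt : e.target ∈ 𝓝 a := extChartAt_target_mem_nhds_of_isInteriorPoint hp
  have hsrc : e.source ∈ 𝓝 p := extChartAt_source_mem_nhds p
  have hae : e.symm a = p := extChartAt_to_inv p
  let g : E → F := c ∘ f ∘ e.symm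
  have hrange : range I ∈ 𝓝 a := mem_interior_iff_mem_nhds.1 hp
  have hg : ContDiffAt ℝ ∞ g a := ((contMDiffAt_iff.1 hf).2).contDiffAt hrange
  let g' : E →L[ℝ] F := fderiv ℝ g a
  have hg' : mfderiv I 𝓘(ℝ, F) f p = g' :=
    (hf.mdifferentiableAt (by simp)).mfderiv.trans (fderivWithin_of_mem_nhds hrange)
  have hgs : Function.Surjective g' := by rw [hg'] at hs; exact hs
  obtain ⟨P, hP⟩ := Submodule.ClosedComplemented.of_finiteDimensional g'.ker
  -- complete `f`, read in charts, by a linear projection onto the kernel of its differential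
  let G : E → F × g'.ker := fun x => (g x, P (x - a))
  have hG : ContDiffAt ℝ ∞ G a :=
    hg.prodMk (P.contDiff.contDiffAt.comp a (contDiffAt_id.sub contDiffAt_const))
  let G' : E ≃L[ℝ] F × g'.ker := ContinuousLinearEquiv.ofBijective (g'.prod P)
    (by
      refine LinearMap.ker_eq_bot'.2 fun x hx => ?_
      have h1 : g' x = 0 := congrArg Prod.fst hx
      have h2 : P x = 0 := congrArg Prod.snd hx
      have h3 := hP ⟨x, h1⟩
      simp only at h3
      rw [h2] at h3
      exact (congrArg Subtype.val h3).symm)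
    (by
      refine LinearMap.range_eq_top.2 ?_
      rintro ⟨y, k⟩
      obtain ⟨x, hx⟩ := hgs y
      refine ⟨x - P x + k, Prod.ext ?_ ?_⟩
      · have h1 : g' (P x) = 0 := (P x).2
        have h2 : g' k = 0 := k.2
        simp [hx, h1, h2]
      · simp [hP])
  have hG' : HasFDerivAt G (G' : E →L[ℝ] F × g'.ker) a := by
    have h1 : HasFDerivAt g g' a := (hg.differentiableAt (by simp)).hasFDerivAt
    have h2 : HasFDerivAt (fun x => P (x - a)) P a :=
      P.hasFDerivAt.comp a ((hasFDerivAt_id a).sub_const a)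
    exact h1.prodMk h2
  let Φ := hG.toOpenPartialHomeomorph G hG' (by simp)
  have hΦ : ∀ x, Φ x = G x := fun x => rfl
  have haΦ : a ∈ Φ.source := hG.mem_toOpenPartialHomeomorph_source hG' (by simp)
  have hga : g a = c (f p) := by simp [g, hae]
  have hGa : G a = (c (f p), 0) := by simp [G, hga]
  have hΦt : (c (f p), (0 : g'.ker)) ∈ Φ.target := by
    rw [← hGa]; exact Φ.map_source haΦ
  have hΦs : Φ.symm (c (f p), 0) = a := by rw [← hGa]; exact Φ.left_inv haΦ
  have hΦsm : ContDiffAt ℝ ∞ Φ.symm (c (f p), 0) := by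
    rw [← hGa]; exact hG.to_localInverse hG' (by simp)
  let ψ : X × g'.ker → F × g'.ker := fun z => (c z.1, z.2)
  have hψ : ContMDiffAt (𝓘(ℝ, F).prod 𝓘(ℝ, g'.ker)) 𝓘(ℝ, F × g'.ker) ∞ ψ (f p, 0) := by
    have h1 : ContMDiffAt (𝓘(ℝ, F).prod 𝓘(ℝ, g'.ker)) 𝓘(ℝ, F) ∞ (fun z : X × g'.ker => c z.1)
        (f p, 0) := contMDiffAt_extChartAt.comp (f p, (0 : g'.ker)) contMDiffAt_fst
    exact h1.prodMk_space contMDiffAt_snd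
  let y : X × g'.ker → E := fun z => Φ.symm (ψ z)
  have hy : ContMDiffAt (𝓘(ℝ, F).prod 𝓘(ℝ, g'.ker)) 𝓘(ℝ, E) ∞ y (f p, 0) :=
    hΦsm.contMDiffAt.comp (f p, (0 : g'.ker)) hψ
  have hy0 : y (f p, 0) = a := hΦs
  have hesm : ContMDiffAt 𝓘(ℝ, E) I ∞ e.symm a :=
    (contMDiffOn_extChartAt_symm p).contMDiffAt htgt
  have hι : ContMDiffAt (𝓘(ℝ, F).prod 𝓘(ℝ, g'.ker)) I ∞ (fun z => e.symm (y z)) (f p, 0) := by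
    refine ContMDiffAt.comp (f p, (0 : g'.ker)) (g := e.symm) ?_ hy
    rw [hy0]; exact hesm
  have hev : ∀ᶠ z in 𝓝 (f p, (0 : g'.ker)), G (y z) = ψ z := by
    have : ∀ᶠ z in 𝓝 (f p, (0 : g'.ker)), ψ z ∈ Φ.target :=
      hψ.continuousAt.preimage_mem_nhds (Φ.open_target.mem_nhds hΦt)
    filter_upwards [this] with z hz
    exact Φ.right_inv hz
  refine ⟨g'.ker, fun z => e.symm (y z), fun q => P (e q - a), ?_, ?_, ?_, hι, ?_, ?_, ?_, ?_⟩
  · rw [← LinearMap.finrank_range_add_finrank_ker (g' : E →ₗ[ℝ] F),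
      LinearMap.range_eq_top.2 hgs, finrank_top]
  · simp only [hy0, hae]
  · simp [ha]
  · have h1 : ContMDiffAt I 𝓘(ℝ, E) ∞ e p := contMDiffAt_extChartAt
    exact (P.contDiff.comp (contDiff_id.sub contDiff_const)).contMDiff.contMDiffAt.comp p h1
  · have h1 : ∀ᶠ z in 𝓝 (f p, (0 : g'.ker)), f (e.symm (y z)) ∈ c.source := by
      have : ContinuousAt (fun z => f (e.symm (y z))) (f p, (0 : g'.ker)) := by
        refine ContinuousAt.comp (g := f) ?_ hι.continuousAt
        simp only [hy0, hae]
        exact hf.continuousAt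
      refine this.preimage_mem_nhds ?_
      simp only [hy0, hae]
      exact extChartAt_source_mem_nhds _
    have h2 : ∀ᶠ z in 𝓝 (f p, (0 : g'.ker)), z.1 ∈ c.source :=
      continuousAt_fst.preimage_mem_nhds (extChartAt_source_mem_nhds _)
    filter_upwards [h1, h2, hev] with z hz1 hz2 hz3
    exact c.injOn hz1 hz2 (congrArg Prod.fst hz3)
  · have h1 : ∀ᶠ z in 𝓝 (f p, (0 : g'.ker)), y z ∈ e.target :=
      hy.continuousAt.preimage_mem_nhds (by rw [hy0]; exact htgt)
    filter_upwards [h1, hev] with z hz1 hz2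
    rw [e.right_inv hz1]
    exact congrArg Prod.snd hz2
  · have h1 : ∀ᶠ q in 𝓝 p, e q ∈ Φ.source :=
      (continuousAt_extChartAt p).preimage_mem_nhds (Φ.open_source.mem_nhds haΦ)
    filter_upwards [h1, hsrc] with q hq1 hq2
    have h3 : ψ (f q, P (e q - a)) = Φ (e q) := by
      simp [ψ, hΦ, G, g, e.left_inv hq2]
    simp only [y]
    rw [h3, Φ.left_inv hq1, e.left_inv hq2]

end Submersion

/-! ### Inverses in an arrow category -/

namespace ArrowCategory

variable {X C : Type*} {A : ArrowCategory X C}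

theorem compMap_of_eq {g h : C} (e : A.src g = A.tgt h) : A.compMap (g, h) = A.comp g h e :=
  dif_pos e

theorem tgt_compMap {g h : C} (e : A.src g = A.tgt h) : A.tgt (A.compMap (g, h)) = A.tgt g := by
  rw [compMap_of_eq e, A.tgt_comp]

theorem src_compMap {g h : C} (e : A.src g = A.tgt h) : A.src (A.compMap (g, h)) = A.src h := by
  rw [compMap_of_eq e, A.src_comp]

theorem compMap_assoc {g h k : C} (e : A.src g = A.tgt h) (e' : A.src h = A.tgt k) :
    A.compMap (A.compMap (g, h), k) = A.compMap (g, A.compMap (h, k)) := by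
  rw [compMap_of_eq e, compMap_of_eq e', compMap_of_eq ((A.src_comp g h e).trans e'),
    compMap_of_eq (e.trans (A.tgt_comp h k e').symm), A.assoc]

theorem unit_compMap {x : X} {g : C} (e : x = A.tgt g) : A.compMap (A.unit x, g) = g := by
  subst e
  rw [compMap_of_eq (A.src_unit _), A.unit_comp]

theorem compMap_unit {x : X} {g : C} (e : A.src g = x) : A.compMap (g, A.unit x) = g := by
  subst e
  rw [compMap_of_eq (A.tgt_unit _).symm, A.comp_unit]

/-- `g'` is a two-sided inverse of `g`. -/
structure IsInverse (A : ArrowCategory X C) (g g' : C) : Prop where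
  src_eq : A.src g = A.tgt g'
  tgt_eq : A.src g' = A.tgt g
  comp_inv : A.compMap (g, g') = A.unit (A.tgt g)
  inv_comp : A.compMap (g', g) = A.unit (A.src g)

theorem IsInverse.symm {g g' : C} (h : A.IsInverse g g') : A.IsInverse g' g :=
  ⟨h.tgt_eq, h.src_eq, h.src_eq ▸ h.inv_comp, h.tgt_eq ▸ h.comp_inv⟩

theorem mem_core_iff {g : C} : g ∈ A.core ↔ ∃ g', A.IsInverse g g' := by
  constructor
  · rintro ⟨g', h1, h2, h3, h4⟩
    exact ⟨g', h2, h1, by rw [compMap_of_eq h2, h4], by rw [compMap_of_eq h1, h3]⟩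
  · rintro ⟨g', h2, h1, h4, h3⟩
    exact ⟨g', h1, h2, by rw [← h3, compMap_of_eq h1], by rw [← h4, compMap_of_eq h2]⟩

theorem IsInverse.compMap_cancel {a a' h : C} (ha : A.IsInverse a a') (e : A.src a = A.tgt h) :
    A.compMap (a', A.compMap (a, h)) = h := by
  rw [← compMap_assoc ha.tgt_eq e, ha.inv_comp, unit_compMap e]

end ArrowCategory

/-! ### Translations by invertible arrows preserve the interior -/

section Translation

/-- Composition with a map which is smooth only along a set `t`, when the inner map takes values
in `t` near the point. -/
theorem ContMDiffWithinAt.comp_contMDiffAt_of_eventually_mem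
    {E H M E' H' N E'' H'' P : Type*} [NormedAddCommGroup E] [NormedSpace ℝ E] [TopologicalSpace H]
    {I : ModelWithCorners ℝ E H} [TopologicalSpace M] [ChartedSpace H M]
    [NormedAddCommGroup E'] [NormedSpace ℝ E'] [TopologicalSpace H']
    {I' : ModelWithCorners ℝ E' H'} [TopologicalSpace N] [ChartedSpace H' N]
    [NormedAddCommGroup E''] [NormedSpace ℝ E''] [TopologicalSpace H'']
    {I'' : ModelWithCorners ℝ E'' H''} [TopologicalSpace P] [ChartedSpace H'' P]
    {n : ℕ∞ω} {g : N → P} {f : M → N} {t : Set N} {x : M} {y : N}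
    (hg : ContMDiffWithinAt I' I'' n g t y) (hf : ContMDiffAt I I' n f x) (hy : f x = y)
    (h : ∀ᶠ z in 𝓝 x, f z ∈ t) : ContMDiffAt I I'' n (fun z => g (f z)) x := by
  subst hy
  have h1 : ContMDiffWithinAt I I'' n (g ∘ f) (f ⁻¹' t) x :=
    hg.comp x hf.contMDiffWithinAt fun _ hz => hz
  exact h1.contMDiffAt h

theorem finrank_add_finrank_lt_of_injective {E F K : Type*} [AddCommGroup E] [Module ℝ E]
    [AddCommGroup F] [Module ℝ F] [AddCommGroup K] [Module ℝ K] [FiniteDimensional ℝ E]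
    {lam : E →ₗ[ℝ] ℝ} (hlam : lam ≠ 0) {T : E →ₗ[ℝ] F} (hT : ∀ w, ∃ v, lam v = 0 ∧ T v = w)
    {D : K →ₗ[ℝ] E} (hD : Function.Injective D) (hlD : ∀ w, lam (D w) = 0)
    (hTD : ∀ w, T (D w) = 0) : Module.finrank ℝ F + Module.finrank ℝ K < Module.finrank ℝ E := by
  have h1 : Module.finrank ℝ lam.ker < Module.finrank ℝ E :=
    Submodule.finrank_lt (fun h => hlam (LinearMap.ker_eq_top.1 h))
  let B : lam.ker →ₗ[ℝ] F := T.comp lam.ker.subtype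
  have hB : B.range = ⊤ := LinearMap.range_eq_top.2 fun w => by
    obtain ⟨v, hv, hw⟩ := hT w
    exact ⟨⟨v, hv⟩, hw⟩
  have h2 := LinearMap.finrank_range_add_finrank_ker B
  rw [hB, finrank_top] at h2
  let D' : K →ₗ[ℝ] B.ker := (D.codRestrict lam.ker hlD).codRestrict B.ker hTD
  have h3 : Module.finrank ℝ K ≤ Module.finrank ℝ B.ker :=
    LinearMap.finrank_le_finrank_of_injective (f := D') fun x y hxy =>
      hD (congrArg (fun z : B.ker => ((z : lam.ker) : E)) hxy)
  omega

variable {E H F : Type*} [NormedAddCommGroup E] [NormedSpace ℝ E] [TopologicalSpace H]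
  [NormedAddCommGroup F] [NormedSpace ℝ F] {I : ModelWithCorners ℝ E H} {lam : E →L[ℝ] ℝ}
  {X C : Type*} [TopologicalSpace X] [ChartedSpace F X] [TopologicalSpace C] [ChartedSpace H C]
  {A : ArrowCategory X C}

/-- A differentiable map defined on a whole normed space has differential tangent to the boundary at
every point it sends to the boundary: the boundary covector has a minimum there. -/
theorem lam_mfderiv_eq_zero_of_isBoundaryPoint (hI : IsBoundaryModel I lam) {K : Type*}
    [NormedAddCommGroup K] [NormedSpace ℝ K] {ψ : K → C} {x : K}
    (hlam : lam (extChartAt I (ψ x) (ψ x)) = 0)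
    {D : K →L[ℝ] E} (hD : HasMFDerivAt 𝓘(ℝ, K) I ψ x D) (w : K) : lam (D w) = 0 := by
  have h1 : HasFDerivAt (fun z => extChartAt I (ψ x) (ψ z)) D x := by
    have h : HasFDerivWithinAt (fun z => extChartAt I (ψ x) (ψ z)) D (range 𝓘(ℝ, K)) x := hD.2
    rwa [modelWithCornersSelf_coe, range_id, hasFDerivWithinAt_univ] at h
  have h2 : HasFDerivAt (fun z => lam (extChartAt I (ψ x) (ψ z))) (lam.comp D) x :=
    lam.hasFDerivAt.comp x h1
  have h3 : IsLocalMin (fun z => lam (extChartAt I (ψ x) (ψ z))) x := by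
    filter_upwards with z
    rw [hlam]
    have h4 : extChartAt I (ψ x) (ψ z) ∈ range I := by
      rw [extChartAt_coe]
      exact mem_range_self _
    rw [hI] at h4
    exact h4
  exact congrArg (fun L : K →L[ℝ] ℝ => L w) (h3.hasFDerivAt_eq_zero h2)

namespace ArrowCategory

/-- Left translation by an invertible arrow `a` sends interior points to interior points. Otherwise,
it would carry the `tgt`-fibre through an interior point `h`, of dimension `dim C - dim X`, with
injective differential into vectors tangent both to the boundary and to a `tgt`-fibre. By
transversality of the fibres to the boundary these form a space of smaller dimension. -/
theorem IsInverse.compMap_mem_interior (hA : A.IsLieCategory (F := F) I lam) {a a' h : C}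
    (ha : A.IsInverse a a') (e : A.src a = A.tgt h) (hh : I.IsInteriorPoint h) :
    I.IsInteriorPoint (A.compMap (a, h)) := by
  have := hA.finiteDimensional_arrows
  have := hA.finiteDimensional_objects
  have := hA.manifold_arrows
  by_contra hbd
  by_cases hlam : lam = 0
  · exact hbd (hA.boundaryModel.isInteriorPoint_of_eq_zero hlam _)
  -- `ψ` is left translation by `a` in linear coordinates of the `tgt`-fibre through `h`
  obtain ⟨K, ι, π, hK, hι0, hπ0, hι, hπ, htι, hπι, -⟩ :=
    exists_submersion_coordinates (hA.tgt_submersion.1 h) hh (hA.tgt_submersion.2 h)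
  let j : K → X × K := fun w => (A.tgt h, w)
  have hj : ContMDiffAt 𝓘(ℝ, K) (𝓘(ℝ, F).prod 𝓘(ℝ, K)) ∞ j 0 :=
    contMDiffAt_const.prodMk contMDiffAt_id
  have htι' : ∀ᶠ w in 𝓝 (0 : K), A.tgt (ι (j w)) = A.tgt h := hj.continuousAt.eventually htι
  have hπι' : ∀ᶠ w in 𝓝 (0 : K), π (ι (j w)) = w := hj.continuousAt.eventually hπι
  let ψ : K → C := fun w => A.compMap (a, ι (j w))
  have hψ0 : ψ 0 = A.compMap (a, h) := by simp only [ψ, j, hι0]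
  have hψ : ContMDiffAt 𝓘(ℝ, K) I ∞ ψ 0 := by
    refine (hA.comp_smooth (a, h) e).comp_contMDiffAt_of_eventually_mem
      (f := fun w => (a, ι (j w))) (contMDiffAt_const.prodMk (hι.comp (0 : K) hj)) ?_ ?_
    · simp only [j, hι0]
    · filter_upwards [htι'] with w hw
      exact e.trans hw.symm
  -- `ρ` is a left inverse of `ψ`, smooth along the `tgt`-fibre `Z` that contains the image of `ψ`
  let ρ : C → K := fun q => π (A.compMap (a', q))
  let Z : Set C := {q | A.src a' = A.tgt q}
  have hψZ : ∀ᶠ w in 𝓝 (0 : K), ψ w ∈ Z := by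
    filter_upwards [htι'] with w hw
    exact ha.tgt_eq.trans (tgt_compMap (e.trans hw.symm)).symm
  have hρψ : ∀ᶠ w in 𝓝 (0 : K), ρ (ψ w) = w := by
    filter_upwards [htι', hπι'] with w hw hw'
    simp only [ρ, ψ, ha.compMap_cancel (e.trans hw.symm), hw']
  have hZ0 : ψ 0 ∈ Z := hψZ.self_of_nhds
  have hρ : ContMDiffWithinAt I 𝓘(ℝ, K) ∞ ρ Z (ψ 0) := by
    have h1 : ContMDiffWithinAt I I ∞ (fun q => A.compMap (a', q)) Z (ψ 0) :=
      (hA.comp_smooth (a', ψ 0) hZ0).comp (ψ 0)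
        (contMDiffWithinAt_const.prodMk contMDiffWithinAt_id) fun q hq => hq
    refine ContMDiffAt.comp_contMDiffWithinAt (g := π) (ψ 0) ?_ h1
    rw [hψ0, ha.compMap_cancel e]
    exact hπ
  obtain ⟨D, hD⟩ : ∃ D : K →L[ℝ] E, HasMFDerivAt 𝓘(ℝ, K) I ψ 0 D :=
    ⟨_, (hψ.mdifferentiableAt (by simp)).hasMFDerivAt⟩
  obtain ⟨D', hD'⟩ : ∃ D' : E →L[ℝ] K, HasMFDerivWithinAt I 𝓘(ℝ, K) ρ Z (ψ 0) D' :=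
    ⟨_, (hρ.mdifferentiableWithinAt (by simp)).hasMFDerivWithinAt⟩
  have hDinj : Function.Injective D := by
    have h1 : HasMFDerivAt 𝓘(ℝ, K) 𝓘(ℝ, K) (ρ ∘ ψ) 0 (D'.comp D) :=
      (hD'.comp 0 hD.hasMFDerivWithinAt fun w hw => hw : HasMFDerivWithinAt 𝓘(ℝ, K) 𝓘(ℝ, K)
        (ρ ∘ ψ) (ψ ⁻¹' Z) 0 (D'.comp D)).hasMFDerivAt hψZ
    have h2 : HasMFDerivAt 𝓘(ℝ, K) 𝓘(ℝ, K) (ρ ∘ ψ) 0 (ContinuousLinearMap.id ℝ K) :=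
      (hasMFDerivAt_id (0 : K)).congr_of_eventuallyEq hρψ
    have h3 : D'.comp D = ContinuousLinearMap.id ℝ K := hasMFDerivAt_unique h1 h2
    exact Function.LeftInverse.injective (g := D') fun w =>
      congrArg (fun L : K →L[ℝ] K => L w) h3
  have hbd' : I.IsBoundaryPoint (ψ 0) := by
    rw [I.isBoundaryPoint_iff_not_isInteriorPoint, hψ0]
    exact hbd
  have hlD : ∀ w, lam (D w) = 0 := lam_mfderiv_eq_zero_of_isBoundaryPoint hA.boundaryModel
    ((isBoundaryPoint_iff_extChartAt_eq_zero hA.boundaryModel hlam (mem_chart_source H _)).1 hbd')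
    hD
  let T : E →L[ℝ] F := mfderiv I 𝓘(ℝ, F) A.tgt (ψ 0)
  have hTD : T.comp D = 0 := by
    have h1 : HasMFDerivAt 𝓘(ℝ, K) 𝓘(ℝ, F) (A.tgt ∘ ψ) 0 (T.comp D) :=
      ((hA.tgt_submersion.1 (ψ 0)).mdifferentiableAt (by simp)).hasMFDerivAt.comp 0 hD
    have h2 : HasMFDerivAt 𝓘(ℝ, K) 𝓘(ℝ, F) (A.tgt ∘ ψ) 0 (0 : K →L[ℝ] F) := by
      refine (hasMFDerivAt_const (A.tgt (ψ 0)) (0 : K)).congr_of_eventuallyEq ?_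
      filter_upwards [hψZ] with w hw
      exact hw.symm.trans hZ0
    exact hasMFDerivAt_unique h1 h2
  have hlt := finrank_add_finrank_lt_of_injective (lam := (lam : E →ₗ[ℝ] ℝ))
    (fun h => hlam (ContinuousLinearMap.coe_injective h)) (T := (T : E →ₗ[ℝ] F))
    (fun w => hA.tgt_boundary_submersion (ψ 0) hbd' w) (D := (D : K →ₗ[ℝ] E)) hDinj hlD
    (fun w => congrArg (fun L : K →L[ℝ] F => L w) hTD)
  omega

end ArrowCategory

end Translation

/-! ### Solving for inverses -/

section Inverses

/-- A parametric form of the open mapping property: if `Ψ a` has a right inverse near `b` that is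
differentiable at `k`, then `Ψ (x, y) = k` is solvable with `y` near `b` for all `x` near `a`. -/
theorem ContDiffAt.eventually_exists_eq {V K L : Type*} [NormedAddCommGroup V] [NormedSpace ℝ V]
    [NormedAddCommGroup K] [NormedSpace ℝ K] [NormedAddCommGroup L] [NormedSpace ℝ L]
    [FiniteDimensional ℝ V] [FiniteDimensional ℝ K] [FiniteDimensional ℝ L]
    {Ψ : V × K → L} {a : V} {b : K} (hΨ : ContDiffAt ℝ ∞ Ψ (a, b)) {β : L → K} {k : L}
    (hβ : DifferentiableAt ℝ β k) (hβ0 : β k = b) (hΨβ : ∀ᶠ l in 𝓝 k, Ψ (a, β l) = l)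
    {p : V × K → Prop} (hp : ∀ᶠ z in 𝓝 (a, b), p z) :
    ∀ᶠ x in 𝓝 a, ∃ y, p (x, y) ∧ Ψ (x, y) = k := by
  let Ψ' := fderiv ℝ Ψ (a, b)
  let Θ : V × K → V × L := fun z => (z.1, Ψ z)
  have hΘ : HasStrictFDerivAt Θ ((ContinuousLinearMap.fst ℝ V K).prod Ψ') (a, b) :=
    hasStrictFDerivAt_fst.prodMk (hΨ.hasStrictFDerivAt (by simp))
  -- differentiating `Ψ (a, β l) = l` shows that the partial differential of `Ψ` is surjective
  have hsurj : ∀ l, Ψ' (0, fderiv ℝ β k l) = l := by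
    have h1 : HasFDerivAt (fun l => (a, β l)) ((0 : L →L[ℝ] V).prod (fderiv ℝ β k)) k :=
      (hasFDerivAt_const a k).prodMk hβ.hasFDerivAt
    have h2 : HasFDerivAt Ψ Ψ' (a, β k) := by
      rw [hβ0]
      exact (hΨ.differentiableAt (by simp)).hasFDerivAt
    have h3 := (h2.comp k h1).unique ((hasFDerivAt_id k).congr_of_eventuallyEq hΨβ)
    exact fun l => congrArg (fun T : L →L[ℝ] L => T l) h3
  have hrange : ((ContinuousLinearMap.fst ℝ V K).prod Ψ').range = ⊤ := by
    refine LinearMap.range_eq_top.2 ?_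
    rintro ⟨v, l⟩
    refine ⟨(v, 0) + (0, fderiv ℝ β k (l - Ψ' (v, 0))), Prod.ext ?_ ?_⟩
    · simp
    · change Ψ' (_ + _) = l
      rw [map_add, hsurj, add_sub_cancel]
  have hmap := hΘ.map_nhds_eq_of_surj hrange
  have h0 : Θ (a, b) = (a, k) := by
    have := hΨβ.self_of_nhds
    rw [hβ0] at this
    simp only [Θ, this]
  have himage : Θ '' {z | p z} ∈ 𝓝 (a, k) := by
    rw [← h0, ← hmap]
    exact image_mem_map hp
  have hcont : ContinuousAt (fun x : V => (x, k)) a := by fun_prop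
  filter_upwards [hcont.preimage_mem_nhds himage] with x hx
  obtain ⟨⟨x', y⟩, hz, h⟩ := hx
  obtain rfl : x' = x := congrArg Prod.fst h
  exact ⟨y, hz, congrArg Prod.snd h⟩

variable {V F M X : Type*} [NormedAddCommGroup V] [NormedSpace ℝ V] [FiniteDimensional ℝ V]
  [NormedAddCommGroup F] [NormedSpace ℝ F] [FiniteDimensional ℝ F]
  [TopologicalSpace M] [ChartedSpace V M] [IsManifold 𝓘(ℝ, V) ∞ M]
  [TopologicalSpace X] [ChartedSpace F X]

/-- Let `m` be a partial multiplication on a manifold `M` without boundary, smooth along the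
composable pairs near `(g₀, h₀)` and `(h₀, 1)`, where `h₀` is inverse to `g₀`. Then every `g` near
`g₀` has a right inverse near `h₀`. In coordinates on the `tgt`-fibres, `g h = 1` is an equation for
the coordinates `w` of `h`; at `g = g₀`, left translation by `h₀` is a right inverse of the map
`h ↦ g₀ h`, so the open mapping property applies. -/
theorem eventually_exists_right_inverse {src tgt : M → X} {u : X → M} {m : M × M → M} {g₀ h₀ : M}
    (hsrc : ContMDiffAt 𝓘(ℝ, V) 𝓘(ℝ, F) ∞ src g₀) (htgt : ContMDiff 𝓘(ℝ, V) 𝓘(ℝ, F) ∞ tgt)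
    (htgt' : ∀ p, Function.Surjective (mfderiv 𝓘(ℝ, V) 𝓘(ℝ, F) tgt p))
    (hu : ContMDiffAt 𝓘(ℝ, F) 𝓘(ℝ, V) ∞ u (tgt g₀)) (htu : ∀ x, tgt (u x) = x)
    (e₀ : src g₀ = tgt h₀) (e₁ : src h₀ = tgt g₀)
    (hm₀ : ContMDiffWithinAt (𝓘(ℝ, V).prod 𝓘(ℝ, V)) 𝓘(ℝ, V) ∞ m
      {p | src p.1 = tgt p.2} (g₀, h₀))
    (hm₁ : ContMDiffWithinAt (𝓘(ℝ, V).prod 𝓘(ℝ, V)) 𝓘(ℝ, V) ∞ m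
      {p | src p.1 = tgt p.2} (h₀, u (tgt g₀)))
    (hgh : m (g₀, h₀) = u (tgt g₀)) (hhu : m (h₀, u (tgt g₀)) = h₀)
    (htm₀ : ∀ᶠ p in 𝓝 (g₀, h₀), src p.1 = tgt p.2 → tgt (m p) = tgt p.1)
    (htm₁ : ∀ᶠ γ in 𝓝 (u (tgt g₀)), src h₀ = tgt γ →
      tgt (m (h₀, γ)) = tgt h₀ ∧ m (g₀, m (h₀, γ)) = γ)
    {W : Set M} (hW : W ∈ 𝓝 h₀) :
    ∀ᶠ g in 𝓝 g₀, ∃ h ∈ W, src g = tgt h ∧ m (g, h) = u (tgt g) := by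
  obtain ⟨K, ι, π, -, hι0, hπ0, hι, hπ, htι, hπι, hιπ⟩ :=
    exists_submersion_coordinates (htgt h₀) BoundarylessManifold.isInteriorPoint (htgt' h₀)
  obtain ⟨K₁, ι₁, π₁, -, hι0₁, hπ0₁, hι₁, hπ₁, htι₁, hπι₁, hιπ₁⟩ :=
    exists_submersion_coordinates (htgt (u (tgt g₀))) BoundarylessManifold.isInteriorPoint
      (htgt' (u (tgt g₀)))
  rw [htu] at hι0₁ hι₁ htι₁ hπι₁
  rw [← e₀] at hι0 hι htι hπι
  set y := tgt g₀ with hy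
  set c := extChartAt 𝓘(ℝ, V) g₀ with hc
  set a := c g₀ with ha
  have hca : c.symm a = g₀ := extChartAt_to_inv g₀
  -- `hh (v, w)` runs through the elements composable with the one with coordinates `v`
  let s : V × K → M := fun z => c.symm z.1
  let r : V × K → X × K := fun z => (src (s z), z.2)
  let hh : V × K → M := fun z => ι (r z)
  let mm : V × K → M := fun z => m (s z, hh z)
  let uu : V × K → M := fun z => u (tgt (s z))
  have hs0 : s (a, 0) = g₀ := hca
  have hr0 : r (a, 0) = (src g₀, 0) := by simp only [r, hs0]
  have hh0 : hh (a, 0) = h₀ := by simp only [hh, hr0, hι0]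
  have hmm0 : mm (a, 0) = u y := by simp only [mm, hs0, hh0, hgh]
  have huu0 : uu (a, 0) = u y := by simp only [uu, hs0, hy]
  have hs : ContMDiffAt 𝓘(ℝ, V × K) 𝓘(ℝ, V) ∞ s (a, 0) := by
    have h1 : ContMDiffAt 𝓘(ℝ, V) 𝓘(ℝ, V) ∞ c.symm a :=
      (contMDiffOn_extChartAt_symm g₀).contMDiffAt (extChartAt_target_mem_nhds g₀)
    exact h1.comp (a, (0 : K)) contDiff_fst.contMDiff.contMDiffAt
  have hr : ContMDiffAt 𝓘(ℝ, V × K) (𝓘(ℝ, F).prod 𝓘(ℝ, K)) ∞ r (a, 0) :=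
    (hsrc.comp_of_eq hs hs0).prodMk contDiff_snd.contMDiff.contMDiffAt
  have hhh : ContMDiffAt 𝓘(ℝ, V × K) 𝓘(ℝ, V) ∞ hh (a, 0) := hι.comp_of_eq hr hr0
  have hcomp : ∀ᶠ z in 𝓝 (a, (0 : K)), tgt (hh z) = src (s z) := by
    have := hr.continuousAt.tendsto
    rw [hr0] at this
    exact this.eventually htι
  have hmm : ContMDiffAt 𝓘(ℝ, V × K) 𝓘(ℝ, V) ∞ mm (a, 0) := by
    refine hm₀.comp_contMDiffAt_of_eventually_mem (f := fun z => (s z, hh z)) (hs.prodMk hhh) ?_ ?_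
    · rw [hs0, hh0]
    · filter_upwards [hcomp] with z hz
      exact hz.symm
  have huu : ContMDiffAt 𝓘(ℝ, V × K) 𝓘(ℝ, V) ∞ uu (a, 0) :=
    hu.comp_of_eq (htgt.contMDiffAt.comp (a, (0 : K)) hs) (by simp only [hs0, hy])
  let Ψ : V × K → K₁ := fun z => π₁ (mm z) - π₁ (uu z)
  have hΨ : ContDiffAt ℝ ∞ Ψ (a, 0) :=
    ((hπ₁.comp_of_eq hmm hmm0).sub (hπ₁.comp_of_eq huu huu0)).contDiffAt
  -- `w ↦ π (δ w)`, left translation by `h₀` in coordinates, is a right inverse of `Ψ (a, ·)`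
  let δ : K₁ → M := fun w => m (h₀, ι₁ (y, w))
  have hj : ContMDiffAt 𝓘(ℝ, K₁) (𝓘(ℝ, F).prod 𝓘(ℝ, K₁)) ∞ (fun w : K₁ => (y, w)) 0 :=
    contMDiffAt_const.prodMk contMDiffAt_id
  have hγ : ContMDiffAt 𝓘(ℝ, K₁) 𝓘(ℝ, V) ∞ (fun w => ι₁ (y, w)) 0 := hι₁.comp (0 : K₁) hj
  have htγ : ∀ᶠ w in 𝓝 (0 : K₁), tgt (ι₁ (y, w)) = y := hj.continuousAt.eventually htι₁
  have hπγ : ∀ᶠ w in 𝓝 (0 : K₁), π₁ (ι₁ (y, w)) = w := hj.continuousAt.eventually hπι₁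
  have hδ0 : δ 0 = h₀ := by simp only [δ, hι0₁, hhu]
  have hδ : ContMDiffAt 𝓘(ℝ, K₁) 𝓘(ℝ, V) ∞ δ 0 := by
    refine hm₁.comp_contMDiffAt_of_eventually_mem (f := fun w => (h₀, ι₁ (y, w)))
      (contMDiffAt_const.prodMk hγ) (by rw [hι0₁]) ?_
    filter_upwards [htγ] with w hw
    exact e₁.trans hw.symm
  have hβ : DifferentiableAt ℝ (fun w => π (δ w)) 0 :=
    (hπ.comp_of_eq hδ hδ0).contDiffAt.differentiableAt (by simp)
  have hΨβ : ∀ᶠ w in 𝓝 (0 : K₁), Ψ (a, π (δ w)) = w := by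
    have h1 := hγ.continuousAt.tendsto
    have h2 := hδ.continuousAt.tendsto
    rw [hι0₁] at h1
    rw [hδ0] at h2
    filter_upwards [htγ, hπγ, h1.eventually htm₁, h2.eventually hιπ] with w w1 w2 w3 w4
    obtain ⟨w5, w6⟩ := w3 (e₁.trans w1.symm)
    have h3 : hh (a, π (δ w)) = δ w := by
      have : r (a, π (δ w)) = (tgt (δ w), π (δ w)) := by
        simp only [r, s, hca]
        rw [e₀, ← w5]
      simp only [hh]
      rw [this, w4]
    have h4 : mm (a, π (δ w)) = ι₁ (y, w) := by
      simp only [mm, h3, s, hca]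
      exact w6
    have h5 : uu (a, π (δ w)) = u y := by simp only [uu, s, hca, hy]
    simp only [Ψ, h4, h5, w2, hπ0₁, sub_zero]
  have hev : ∀ᶠ z in 𝓝 (a, (0 : K)), hh z ∈ W ∧ tgt (hh z) = src (s z) ∧
      (src (s z) = tgt (hh z) → tgt (mm z) = tgt (s z)) ∧
      ι₁ (tgt (mm z), π₁ (mm z)) = mm z ∧ ι₁ (tgt (uu z), π₁ (uu z)) = uu z := by
    have h1 := hhh.continuousAt.tendsto
    have h2 := (hs.continuousAt.prodMk hhh.continuousAt).tendsto
    have h3 := hmm.continuousAt.tendsto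
    have h4 := huu.continuousAt.tendsto
    rw [hh0] at h1
    rw [hs0, hh0] at h2
    rw [hmm0] at h3
    rw [huu0] at h4
    exact (h1.eventually hW).and (hcomp.and ((h2.eventually htm₀).and
      ((h3.eventually hιπ₁).and (h4.eventually hιπ₁))))
  have hmain := hΨ.eventually_exists_eq hβ (by rw [hδ0, hπ0]) hΨβ hev
  have hcc : Tendsto c (𝓝 g₀) (𝓝 a) := continuousAt_extChartAt g₀
  filter_upwards [hcc.eventually hmain, extChartAt_source_mem_nhds (I := 𝓘(ℝ, V)) g₀] with g hg hgs
  obtain ⟨w, ⟨h1, h2, h3, h4, h5⟩, h6⟩ := hg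
  have h7 : s (c g, w) = g := c.left_inv hgs
  refine ⟨hh (c g, w), h1, by rw [h2, h7], ?_⟩
  have h8 : mm (c g, w) = uu (c g, w) := by
    rw [← h4, ← h5, h3 h2.symm, sub_eq_zero.1 h6, htu]
  simpa only [mm, uu, h7] using h8

end Inverses

/-! ### The core inside a slice -/

namespace ArrowCategory

section CoreAlgebra

variable {X C : Type*} {A : ArrowCategory X C}

/-- An arrow whose right inverse has a right inverse is invertible. -/
theorem IsInverse.of_right_inverses {g h k : C} (e : A.src g = A.tgt h)
    (hgh : A.compMap (g, h) = A.unit (A.tgt g)) (e' : A.src h = A.tgt k)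
    (hhk : A.compMap (h, k) = A.unit (A.tgt h)) : A.IsInverse g h := by
  have e₁ : A.src h = A.tgt g := by rw [← src_compMap e, hgh, A.src_unit]
  have hgk : g = k := by
    calc g = A.compMap (g, A.unit (A.tgt h)) := (compMap_unit e).symm
      _ = A.compMap (A.compMap (g, h), k) := by rw [← hhk, compMap_assoc e e']
      _ = k := by rw [hgh, unit_compMap (e₁.symm.trans e')]
  refine ⟨e, e₁, hgh, ?_⟩
  rw [e, ← hhk, hgk]

end CoreAlgebra

variable {E H F V : Type*} [NormedAddCommGroup E] [NormedSpace ℝ E] [TopologicalSpace H]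
  [NormedAddCommGroup F] [NormedSpace ℝ F] [NormedAddCommGroup V] [NormedSpace ℝ V]
  {I : ModelWithCorners ℝ E H} {lam : E →L[ℝ] ℝ}
  {X C : Type*} [TopologicalSpace X] [ChartedSpace F X] [TopologicalSpace C] [ChartedSpace H C]
  {A : ArrowCategory X C}

theorem surjective_mfderiv_comp_val {S : Set C} (D : SliceData I V S)
    {f : C → X} (hf : ContMDiff I 𝓘(ℝ, F) ∞ f) (p : S)
    (hs : ∀ w : F, ∃ v : V, (mfderiv I 𝓘(ℝ, F) f p : E →L[ℝ] F) (D.incl v) = w) :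
    letI := D.chartedSpace
    Function.Surjective (mfderiv 𝓘(ℝ, V) 𝓘(ℝ, F) (fun q : S => f q) p) := by
  let _ := D.chartedSpace
  have h : HasMFDerivAt 𝓘(ℝ, V) 𝓘(ℝ, F) (fun q : S => f q) p
      ((mfderiv I 𝓘(ℝ, F) f p : E →L[ℝ] F).comp D.incl) :=
    ((hf p).mdifferentiableAt (by simp)).hasMFDerivAt.comp p (D.hasMFDerivAt_val p)
  rw [h.mfderiv]
  exact hs

/-- If a slice `S` contains the core, `tgt` restricts to a submersion on `S`, and composites of
arrows in `S` stay in `S` locally, then the core is open in `S`. -/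
theorem isOpen_core_of_sliceData [FiniteDimensional ℝ V]
    (hA : A.IsLieCategory (F := F) I lam) {S : Set C} (D : SliceData I V S) (hS : A.core ⊆ S)
    (htgt : ∀ p ∈ S, ∀ w : F, ∃ v : V, (mfderiv I 𝓘(ℝ, F) A.tgt p : E →L[ℝ] F) (D.incl v) = w)
    (hcomp : ∀ p ∈ A.composable, A.compMap p ∈ S →
      ∀ᶠ q in 𝓝[A.composable] p, q.1 ∈ S → q.2 ∈ S → A.compMap q ∈ S) :
    IsOpen {g : S | (g : C) ∈ A.core} := by
  classical
  have := hA.finiteDimensional_objects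
  have := hA.manifold_arrows
  let _ := D.chartedSpace
  have := D.isManifold
  have hval := D.contMDiff_val
  let src : S → X := fun g => A.src g
  let tgt : S → X := fun g => A.tgt g
  let u : X → S := fun x => ⟨A.unit x, hS (A.core_isWideSubcategory.unit_mem x)⟩
  let m : S × S → S := fun p =>
    if h : A.compMap (p.1, p.2) ∈ S then ⟨A.compMap (p.1, p.2), h⟩ else p.1
  have hm_val : ∀ {p : S × S}, A.compMap (p.1, p.2) ∈ S → (m p : C) = A.compMap (p.1, p.2) :=
    fun h => congrArg Subtype.val (dif_pos h)
  let R : Set (S × S) := {p | src p.1 = tgt p.2}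
  have hevS : ∀ p ∈ R, A.compMap (p.1, p.2) ∈ S →
      ∀ᶠ q in 𝓝[R] p, A.compMap ((q.1 : C), (q.2 : C)) ∈ S := by
    intro p hp hpS
    have hc : Continuous fun q : S × S => ((q.1 : C), (q.2 : C)) := by fun_prop
    have ht : Tendsto (fun q : S × S => ((q.1 : C), (q.2 : C))) (𝓝[R] p)
        (𝓝[A.composable] ((p.1 : C), (p.2 : C))) :=
      (hc.continuousWithinAt (s := R)).tendsto_nhdsWithin fun q hq => hq
    filter_upwards [ht.eventually (hcomp ((p.1 : C), (p.2 : C)) hp hpS)] with q hq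
    exact hq q.1.2 q.2.2
  have hm : ∀ p ∈ R, A.compMap (p.1, p.2) ∈ S →
      ContMDiffWithinAt (𝓘(ℝ, V).prod 𝓘(ℝ, V)) 𝓘(ℝ, V) ∞ m R p := by
    intro p hp hpS
    refine D.contMDiffWithinAt_of_val ?_
    have h1 : ContMDiffWithinAt (𝓘(ℝ, V).prod 𝓘(ℝ, V)) I ∞
        (fun q : S × S => A.compMap ((q.1 : C), (q.2 : C))) R p := by
      refine ContMDiffWithinAt.comp (t := A.composable) (g := A.compMap)
        (f := fun q : S × S => ((q.1 : C), (q.2 : C))) p (hA.comp_smooth _ hp) ?_ fun q hq => hq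
      exact ((hval.comp contMDiff_fst).prodMk (hval.comp contMDiff_snd)).contMDiffAt
        |>.contMDiffWithinAt
    refine h1.congr_of_eventuallyEq ?_ (hm_val hpS)
    filter_upwards [hevS p hp hpS] with q hq
    exact hm_val hq
  -- the one-sided statement at an invertible arrow, from which invertibility nearby follows
  have key : ∀ g₀ h₀ : S, A.IsInverse (g₀ : C) h₀ → ∀ W ∈ 𝓝 h₀, ∀ᶠ g : S in 𝓝 g₀, ∃ h ∈ W,
      A.src (g : C) = A.tgt (h : C) ∧ A.compMap ((g : C), (h : C)) = A.unit (A.tgt g) := by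
    intro g₀ h₀ hgh W hW
    have e₂ : A.src (h₀ : C) = A.tgt (A.unit (A.tgt (g₀ : C))) :=
      hgh.tgt_eq.trans (A.tgt_unit _).symm
    have hr₀ : (g₀, h₀) ∈ R := hgh.src_eq
    have hr₁ : (h₀, u (tgt g₀)) ∈ R := e₂
    have hS₀ : A.compMap ((g₀ : C), (h₀ : C)) ∈ S := hgh.comp_inv ▸ (u (tgt g₀)).2
    have hv₁ : A.compMap ((h₀ : C), A.unit (A.tgt (g₀ : C))) = h₀ := compMap_unit hgh.tgt_eq
    have hS₁ : A.compMap ((h₀ : C), (u (tgt g₀) : C)) ∈ S := by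
      change A.compMap ((h₀ : C), A.unit (A.tgt (g₀ : C))) ∈ S
      rw [hv₁]
      exact h₀.2
    have hu : ContMDiffAt 𝓘(ℝ, F) 𝓘(ℝ, V) ∞ u (tgt g₀) :=
      D.contMDiffAt_of_val (hA.unit_smooth _)
    have hev₀ := eventually_nhdsWithin_iff.1 (hevS _ hr₀ hS₀)
    have hev₁ : ∀ᶠ γ : S in 𝓝 (u (tgt g₀)), A.src (h₀ : C) = A.tgt (γ : C) →
        A.compMap ((h₀ : C), (γ : C)) ∈ S := by
      have hc : ContinuousAt (fun γ : S => (h₀, γ)) (u (tgt g₀)) := by fun_prop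
      exact hc.eventually (eventually_nhdsWithin_iff.1 (hevS _ hr₁ hS₁))
    obtain ⟨U', hU', W', hW', hUW⟩ : ∃ U' ∈ 𝓝 g₀, ∃ W' ∈ 𝓝 h₀, ∀ q : S × S, q.1 ∈ U' → q.2 ∈ W' →
        q ∈ R → A.compMap ((q.1 : C), (q.2 : C)) ∈ S := by
      obtain ⟨U', hU', W', hW', h⟩ := mem_nhds_prod_iff.1 hev₀
      exact ⟨U', hU', W', hW', fun q h1 h2 => h ⟨h1, h2⟩⟩
    have main := eventually_exists_right_inverse (V := V) (F := F) (src := src) (tgt := tgt)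
      (u := u) (m := m) (g₀ := g₀) (h₀ := h₀) ((hA.src_submersion.1.comp hval).contMDiffAt)
      (hA.tgt_submersion.1.comp hval)
      (fun p => surjective_mfderiv_comp_val D hA.tgt_submersion.1 p (htgt p p.2))
      hu A.tgt_unit hgh.src_eq hgh.tgt_eq (hm _ hr₀ hS₀) (hm _ hr₁ hS₁)
      (Subtype.ext ((hm_val hS₀).trans hgh.comp_inv)) (Subtype.ext ((hm_val hS₁).trans hv₁))
      (by
        filter_upwards [hev₀] with q hq hqR
        change A.tgt (m q : C) = A.tgt (q.1 : C)
        rw [hm_val (hq hqR), tgt_compMap hqR])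
      (by
        filter_upwards [hev₁] with γ hγ hγR
        have h1 : (m (h₀, γ) : C) = A.compMap ((h₀ : C), (γ : C)) := hm_val (hγ hγR)
        have h2 : A.compMap ((g₀ : C), (m (h₀, γ) : C)) = γ := by
          rw [h1, hgh.symm.compMap_cancel hγR]
        refine ⟨?_, Subtype.ext ?_⟩
        · change A.tgt (m (h₀, γ) : C) = A.tgt (h₀ : C)
          rw [h1, tgt_compMap hγR]
        · rw [hm_val (by simpa only [h2] using γ.2)]
          exact h2)
      (inter_mem hW hW')
    filter_upwards [main, hU'] with g hg hgU
    obtain ⟨h, ⟨hhW, hhW'⟩, e, hmgh⟩ := hg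
    refine ⟨h, hhW, e, ?_⟩
    rw [← hm_val (p := (g, h)) (hUW (g, h) hgU hhW' e), hmgh]
  rw [isOpen_iff_mem_nhds]
  intro g₀ hg₀
  obtain ⟨h₀, hgh⟩ := mem_core_iff.1 hg₀
  let h₀' : S := ⟨h₀, hS (mem_core_iff.2 ⟨_, hgh.symm⟩)⟩
  filter_upwards [key g₀ h₀' hgh _ (key h₀' g₀ hgh.symm univ univ_mem)] with g hg
  obtain ⟨h, ⟨k, -, e', hhk⟩, e, hgh'⟩ := hg
  exact mem_core_iff.2 ⟨h, .of_right_inverses e hgh' e' hhk⟩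

end ArrowCategory

/-! ### The Lie category structure on the core -/

namespace ArrowCategory

variable {E H F V : Type*} [NormedAddCommGroup E] [NormedSpace ℝ E] [TopologicalSpace H]
  [NormedAddCommGroup F] [NormedSpace ℝ F] [NormedAddCommGroup V] [NormedSpace ℝ V]
  {I : ModelWithCorners ℝ E H} {lam : E →L[ℝ] ℝ}
  {X C : Type*} [TopologicalSpace X] [ChartedSpace F X] [TopologicalSpace C] [ChartedSpace H C]
  {A : ArrowCategory X C}

/-- A wide subcategory that is a slice along which source and target are submersions is an embedded
Lie subcategory. -/
theorem isEmbeddedLieSubcategory_of_sliceData [FiniteDimensional ℝ V]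
    (hA : A.IsLieCategory (F := F) I lam) {T : Set C} (D : SliceData I V T)
    (hT : A.IsWideSubcategory T)
    (hsrc : ∀ p ∈ T, ∀ w : F, ∃ v : V, (mfderiv I 𝓘(ℝ, F) A.src p : E →L[ℝ] F) (D.incl v) = w)
    (htgt : ∀ p ∈ T, ∀ w : F, ∃ v : V, (mfderiv I 𝓘(ℝ, F) A.tgt p : E →L[ℝ] F) (D.incl v) = w) :
    letI := D.chartedSpace
    A.IsEmbeddedLieSubcategory (F := F) I 𝓘(ℝ, V) 0 T hT := by
  have := hA.finiteDimensional_objects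
  have := hA.manifold_arrows
  let _ := D.chartedSpace
  have := D.isManifold
  have hval := D.contMDiff_val
  refine ⟨?_, D.isSmoothEmbedding_val⟩
  refine
    { finiteDimensional_arrows := inferInstance
      finiteDimensional_objects := inferInstance
      boundaryModel := by
        ext
        simp
      manifold_arrows := inferInstance
      manifold_objects := hA.manifold_objects
      src_submersion := ⟨hA.src_submersion.1.comp hval,
        fun p => surjective_mfderiv_comp_val D hA.src_submersion.1 p (hsrc p p.2)⟩
      tgt_submersion := ⟨hA.tgt_submersion.1.comp hval,
        fun p => surjective_mfderiv_comp_val D hA.tgt_submersion.1 p (htgt p p.2)⟩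
      unit_smooth := fun x => D.contMDiffAt_of_val (hA.unit_smooth x)
      comp_smooth := ?_
      src_boundary_submersion := ?_
      tgt_boundary_submersion := ?_ }
  · intro p hp
    refine D.contMDiffWithinAt_of_val ?_
    have h1 : ContMDiffWithinAt (𝓘(ℝ, V).prod 𝓘(ℝ, V)) I ∞
        (fun q : T × T => A.compMap ((q.1 : C), (q.2 : C))) (A.restrict T hT).composable p := by
      refine ContMDiffWithinAt.comp (t := A.composable) (g := A.compMap)
        (f := fun q : T × T => ((q.1 : C), (q.2 : C))) p (hA.comp_smooth _ hp) ?_ fun q hq => hq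
      exact ((hval.comp contMDiff_fst).prodMk (hval.comp contMDiff_snd)).contMDiffAt
        |>.contMDiffWithinAt
    have h2 : ∀ q ∈ (A.restrict T hT).composable,
        ((A.restrict T hT).compMap q : C) = A.compMap ((q.1 : C), (q.2 : C)) := by
      rintro ⟨g, h⟩ e
      have e' : A.src (g : C) = A.tgt (h : C) := e
      rw [compMap_of_eq (A := A.restrict T hT) e, compMap_of_eq e']
      rfl
    exact h1.congr h2 (h2 p hp)
  all_goals
    intro p hp
    rw [ModelWithCorners.Boundaryless.boundary_eq_empty] at hp
    exact hp.elim

theorem core_subset_interior (hA : A.IsLieCategory (F := F) I lam)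
    (hunit : ∀ x, A.unit x ∈ I.interior C) : A.core ⊆ I.interior C := by
  intro g hg
  obtain ⟨g', hgg'⟩ := mem_core_iff.1 hg
  have h := hgg'.compMap_mem_interior hA (A.tgt_unit (A.src g)).symm (hunit _)
  rwa [compMap_unit rfl] at h

theorem core_subset_boundary (hA : A.IsLieCategory (F := F) I lam)
    (hunit : ∀ x, A.unit x ∈ I.boundary C) : A.core ⊆ I.boundary C := by
  intro g hg
  obtain ⟨g', hgg'⟩ := mem_core_iff.1 hg
  refine (I.isBoundaryPoint_iff_not_isInteriorPoint g).2 fun hint => ?_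
  have h := hgg'.symm.compMap_mem_interior hA hgg'.tgt_eq hint
  rw [hgg'.inv_comp] at h
  exact (I.isInteriorPoint_iff_not_isBoundaryPoint _).1 h (hunit _)

/-- Once the core is open in a slice `S` along which source and target are submersions, it is an
embedded Lie subcategory. -/
theorem exists_isEmbeddedLieSubcategory_core {k : ℕ} (hA : A.IsLieCategory (F := F) I lam)
    {S : Set C} (D : SliceData I (EuclideanSpace ℝ (Fin k)) S) (hS : A.core ⊆ S)
    (hopen : IsOpen {g : S | (g : C) ∈ A.core})
    (hsrc : ∀ p ∈ S, ∀ w : F, ∃ v, (mfderiv I 𝓘(ℝ, F) A.src p : E →L[ℝ] F) (D.incl v) = w)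
    (htgt : ∀ p ∈ S, ∀ w : F, ∃ v, (mfderiv I 𝓘(ℝ, F) A.tgt p : E →L[ℝ] F) (D.incl v) = w) :
    ∃ (k : ℕ) (_ : ChartedSpace (EuclideanSpace ℝ (Fin k)) A.core),
      A.IsEmbeddedLieSubcategory (F := F) I 𝓘(ℝ, EuclideanSpace ℝ (Fin k)) 0
        A.core A.core_isWideSubcategory := by
  obtain ⟨O, hO, hOcore⟩ := isOpen_induced_iff.1 hopen
  have hcore : A.core = S ∩ O := by
    ext g
    constructor
    · intro hg
      have h : (⟨g, hS hg⟩ : S) ∈ Subtype.val ⁻¹' O := by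
        rw [hOcore]
        exact hg
      exact ⟨hS hg, h⟩
    · rintro ⟨hgS, hgO⟩
      have h : (⟨g, hgS⟩ : S) ∈ {g : S | (g : C) ∈ A.core} := by
        rw [← hOcore]
        exact hgO
      exact h
  let D' := D.restrictOpen hO hcore
  exact ⟨k, D'.chartedSpace, isEmbeddedLieSubcategory_of_sliceData hA D' _
    (fun p hp => hsrc p (hS hp)) (fun p hp => htgt p (hS hp))⟩

end ArrowCategory

/-- The core of a Lie category `C ⇉ X` with normal boundary is an embedded Lie subcategory (with a
smooth structure without boundary); it lies in `Int C` and is open in `Int C` if the units lie in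
`Int C`, and it lies in `∂C` and is open in `∂C` if the units lie in `∂C`. -/
theorem mainTheorem11
    {E H F X C : Type*} [NormedAddCommGroup E] [NormedSpace ℝ E] [TopologicalSpace H]
    [NormedAddCommGroup F] [NormedSpace ℝ F]
    [TopologicalSpace X] [ChartedSpace F X] [TopologicalSpace C] [ChartedSpace H C]
    (I : ModelWithCorners ℝ E H) (lam : E →L[ℝ] ℝ) (A : ArrowCategory X C)
    (hA : A.IsLieCategory (F := F) I lam) (hbd : A.HasNormalBoundary I) :
    (∃ (k : ℕ) (_ : ChartedSpace (EuclideanSpace ℝ (Fin k)) A.core),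
      A.IsEmbeddedLieSubcategory (F := F) I 𝓘(ℝ, EuclideanSpace ℝ (Fin k)) 0
        A.core A.core_isWideSubcategory) ∧
    ((∀ x, A.unit x ∈ I.interior C) →
      A.core ⊆ I.interior C ∧ IsOpen {g : I.interior C | (g : C) ∈ A.core}) ∧
    ((∀ x, A.unit x ∈ I.boundary C) →
      A.core ⊆ I.boundary C ∧ IsOpen {g : I.boundary C | (g : C) ∈ A.core}) := by
  have := hA.finiteDimensional_arrows
  have := hA.manifold_arrows
  by_cases hint : ∀ x, A.unit x ∈ I.interior C
  · have hS := A.core_subset_interior hA hint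
    let L : E ≃L[ℝ] EuclideanSpace ℝ (Fin (Module.finrank ℝ E)) :=
      ContinuousLinearEquiv.ofFinrankEq (by simp)
    let D : SliceData I (EuclideanSpace ℝ (Fin (Module.finrank ℝ E))) (I.interior C) :=
      SliceData.interior L
    have hsubm : ∀ {f : C → X}, IsSmoothSubmersion (F := F) I f → ∀ p ∈ I.interior C, ∀ w : F,
        ∃ v, (mfderiv I 𝓘(ℝ, F) f p : E →L[ℝ] F) (D.incl v) = w := by
      intro f hf p _ w
      obtain ⟨v, hv⟩ := hf.2 p w
      exact ⟨L v, (congrArg _ (L.symm_apply_apply v)).trans hv⟩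
    have hopen : IsOpen {g : I.interior C | (g : C) ∈ A.core} := by
      refine A.isOpen_core_of_sliceData hA D hS (hsubm hA.tgt_submersion) fun p hp hpS => ?_
      have h := (hA.comp_smooth p hp).continuousWithinAt.preimage_mem_nhdsWithin
        ((I.isOpen_interior (n := ∞) (by simp)).mem_nhds hpS)
      filter_upwards [h] with q hq _ _
      exact hq
    refine ⟨A.exists_isEmbeddedLieSubcategory_core hA D hS hopen (hsubm hA.src_submersion)
      (hsubm hA.tgt_submersion), fun _ => ⟨hS, hopen⟩, fun hbd' => ?_⟩
    -- units cannot be interior and boundary points at once, so `C` is empty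
    have hempty : ∀ g : C, False := fun g =>
      (I.isInteriorPoint_iff_not_isBoundaryPoint _).1 (hint (A.src g)) (hbd' (A.src g))
    exact ⟨fun g _ => (hempty g).elim, isOpen_iff_mem_nhds.2 fun g _ => (hempty g).elim⟩
  · have hwide : A.IsWideSubcategory (I.boundary C) := hbd.resolve_left hint
    -- if `lam = 0`, then `C` has no boundary points and all units are interior
    have hlam : lam ≠ 0 := fun h =>
      hint fun x => hA.boundaryModel.isInteriorPoint_of_eq_zero h _
    have hS := A.core_subset_boundary hA hwide.unit_mem
    obtain ⟨k, j, r, hrj, hj⟩ := exists_linear_parametrization_ker lam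
    let D : SliceData I (EuclideanSpace ℝ (Fin k)) (I.boundary C) :=
      SliceData.boundary hA.boundaryModel hlam j r hrj hj
    have hsubm : ∀ {f : C → X}, IsBoundarySubmersion (F := F) I lam f → ∀ p ∈ I.boundary C,
        ∀ w : F, ∃ v, (mfderiv I 𝓘(ℝ, F) f p : E →L[ℝ] F) (D.incl v) = w := by
      intro f hf p hp w
      obtain ⟨v, hv, hw⟩ := hf p hp w
      obtain ⟨v', rfl⟩ : v ∈ range j := by
        rw [hj]
        exact hv
      exact ⟨v', hw⟩
    have hopen : IsOpen {g : I.boundary C | (g : C) ∈ A.core} := by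
      refine A.isOpen_core_of_sliceData hA D hS (hsubm hA.tgt_boundary_submersion) fun p hp _ => ?_
      filter_upwards [self_mem_nhdsWithin] with q hq h1 h2
      rw [show q = (q.1, q.2) from rfl, ArrowCategory.compMap_of_eq hq]
      exact hwide.comp_mem _ _ _ h1 h2
    exact ⟨A.exists_isEmbeddedLieSubcategory_core hA D hS hopen (hsubm hA.src_boundary_submersion)
      (hsubm hA.tgt_boundary_submersion), fun h => (hint h).elim, fun _ => ⟨hS, hopen⟩⟩
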